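/- Let $\mathbb X$ be a finite-dimensional Euclidean space, let $f:\mathbb X\to\mathbb R$ be continuously differentiable, let $P_1,P_2:\mathbb X\to\mathbb R$ be convex, let $\sigma>0$, and suppose that the set $\mathcal F=\{x\in\mathbb X: P_1(x)-P_2(x)\le\sigma\}$ is nonempty and compact. Consider the problem $$\min_{x\in\mathbb X} f(x)\quad\text{subject to}\quad P_1(x)-P_2(x)\le\sigma. \tag{P0}$$ For a real-valued function $h$ on $\mathbb X$, let $\widehat\partial h(x)=\{v:\liminf_{z\to x,\,z\ne x}\frac{h(z)-h(x)-\langle v,z-x\rangle}{\|z-x\|}\ge 0\}$ be its regular (Fréchet) subdifferential, let $\partial h(x)=\{v:\exists\, x^k\to x,\ h(x^k)\to h(x),\ v^k\in\widehat\partial h(x^k),\ v^k\to v\}$ be its limiting subdifferential (for convex real-valued $h$ this is the usual convex subdifferential), and, for $h$ locally Lipschitz, let $\partial^\circ h(x)=\{v:\limsup_{y\to x,\,t\downarrow0}\frac{h(y+tw)-h(y)}{t}\ge\langle v,w\rangle\ \text{for all } w\in\mathbb X\}$ be its Clarke subdifferential. The generalized Mangasarian–Fromovitz constraint qualification (gMFCQ)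 is said to hold at $x\in\mathcal F$ if $P_1(x)-P_2(x)=\sigma$ implies $0\notin\partial^\circ(P_1-P_2)(x)$. A point $x^*\in\mathbb X$ is called a stationary point of (P0) if there is $\lambda_*\ge0$ such that (i) $0\in\nabla f(x^*)+\lambda_*\bigl(\partial P_1(x^*)-\partial P_2(x^*)\bigr)$, and (ii) $\lambda_*\bigl(P_1(x^*)-P_2(x^*)-\sigma\bigr)=0$ and $P_1(x^*)-P_2(x^*)\le\sigma$. If the gMFCQ holds at every point of $\mathcal F$, then every local minimizer of (P0) is a stationary point of (P0). -/

import Mathlib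

open Filter Topology Set
open scoped Pointwise

noncomputable section

namespace DCOpt

variable {X : Type*} [NormedAddCommGroup X] [InnerProductSpace ℝ X]

/-- The regular (Fréchet) subdifferential of a real-valued function `h` at `x`. The lower limit is
taken in `EReal`, over `z → x` with `z ≠ x`, so no boundedness of the quotients is presupposed. -/
def regularSubdifferential (h : X → ℝ) (x : X) : Set X :=
  {v | (0 : EReal) ≤
    liminf (fun z : X => (((h z - h x - inner ℝ v (z - x)) / ‖z - x‖ : ℝ) : EReal)) (𝓝[≠] x)}

/-- The limiting subdifferential `∂h(x)` of a real-valued function `h` at `x`. For a convex function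
on a finite-dimensional space it is the classical subdifferential of convex analysis. -/
def limitingSubdifferential (h : X → ℝ) (x : X) : Set X :=
  {v | ∃ (xs : ℕ → X) (vs : ℕ → X),
    Tendsto xs atTop (𝓝 x) ∧ Tendsto (fun k => h (xs k)) atTop (𝓝 (h x)) ∧
    (∀ k, vs k ∈ regularSubdifferential h (xs k)) ∧ Tendsto vs atTop (𝓝 v)}

/-- The Clarke generalized directional derivative of `h` at `x` in the direction `w`: the upper
limit of `(h (y + t w) - h y) / t` as `y → x` and `t ↓ 0`, taken in `EReal`. -/
def clarkeDirDeriv (h : X → ℝ) (x w : X) : EReal :=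
  limsup (fun p : X × ℝ => (((h (p.1 + p.2 • w) - h p.1) / p.2 : ℝ) : EReal))
    (𝓝 x ×ˢ 𝓝[>] (0 : ℝ))

/-- The Clarke subdifferential `∂°h(x)`. -/
def clarkeSubdifferential (h : X → ℝ) (x : X) : Set X :=
  {v | ∀ w : X, ((inner ℝ v w : ℝ) : EReal) ≤ clarkeDirDeriv h x w}

/-- The feasible set `F = {x | P₁ x - P₂ x ≤ σ}`. -/
def feasibleSet (P₁ P₂ : X → ℝ) (σ : ℝ) : Set X :=
  {x | P₁ x - P₂ x ≤ σ}

/-- The generalized Mangasarian-Fromovitz constraint qualification at `x`. -/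
def GMFCQAt (P₁ P₂ : X → ℝ) (σ : ℝ) (x : X) : Prop :=
  P₁ x - P₂ x = σ → (0 : X) ∉ clarkeSubdifferential (fun y => P₁ y - P₂ y) x

/-- `x` is a local minimizer of `f` subject to `P₁ - P₂ ≤ σ`: it is feasible, and `f x ≤ f y` for
all feasible `y` in a neighbourhood of `x`. -/
def IsLocalMinimizer (f P₁ P₂ : X → ℝ) (σ : ℝ) (x : X) : Prop :=
  x ∈ feasibleSet P₁ P₂ σ ∧ IsLocalMinOn f (feasibleSet P₁ P₂ σ) x

/-- `x` is a stationary point of the problem of minimizing `f` subject to `P₁ - P₂ ≤ σ`. The sums,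
differences and multiples of sets are elementwise. -/
def IsStationaryPoint [FiniteDimensional ℝ X] (f P₁ P₂ : X → ℝ) (σ : ℝ) (x : X) : Prop :=
  haveI : CompleteSpace X := FiniteDimensional.complete ℝ X
  ∃ l : ℝ, 0 ≤ l ∧
    (0 : X) ∈ ({gradient f x} : Set X) +
      l • (limitingSubdifferential P₁ x - limitingSubdifferential P₂ x) ∧
    l * (P₁ x - P₂ x - σ) = 0 ∧ P₁ x - P₂ x ≤ σ

end DCOpt

end

namespace DCOpt

variable {X : Type*} [NormedAddCommGroup X] [InnerProductSpace ℝ X]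

/-- Subgradients of convex analysis are limiting subgradients. -/
theorem mem_limitingSubdifferential_of_subgradient {h : X → ℝ} {x v : X}
    (hv : ∀ z, h x + inner ℝ v (z - x) ≤ h z) : v ∈ limitingSubdifferential h x := by
  refine ⟨fun _ => x, fun _ => v, tendsto_const_nhds, tendsto_const_nhds, fun _ => ?_,
    tendsto_const_nhds⟩
  rw [regularSubdifferential, mem_ofPred_eq]
  refine le_liminf_of_le (h := Eventually.of_forall fun z => ?_)
  exact_mod_cast div_nonneg (by linarith [hv z]) (norm_nonneg _)

/-- If the Clarke directional derivative is negative, so are the difference quotients at the point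
itself, uniformly for small positive steps. -/
theorem exists_neg_eventually_quotient_lt {h : X → ℝ} {x w : X} (hw : clarkeDirDeriv h x w < 0) :
    ∃ b < (0 : ℝ), ∀ᶠ t in 𝓝[>] (0 : ℝ), (h (x + t • w) - h x) / t < b := by
  obtain ⟨b, hb, hb0⟩ := EReal.lt_iff_exists_real_btwn.1 hw
  refine ⟨b, by exact_mod_cast hb0, ?_⟩
  have hlim : Tendsto (fun t : ℝ => (x, t)) (𝓝[>] 0) (𝓝 x ×ˢ 𝓝[>] (0 : ℝ)) :=
    tendsto_const_nhds.prodMk tendsto_id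
  filter_upwards [hlim.eventually (eventually_lt_of_limsup_lt hb)] with t ht
  exact_mod_cast ht

/-- The right derivative of a convex function of one variable is a subgradient. -/
theorem add_mul_rightDeriv_le {p : ℝ → ℝ} (hp : ConvexOn ℝ univ p) (s t : ℝ) :
    p s + (t - s) * derivWithin p (Ioi s) s ≤ p t := by
  have hs : s ∈ interior (univ : Set ℝ) := by simp
  rcases lt_trichotomy s t with hst | rfl | hst
  · have := hp.rightDeriv_le_slope_of_mem_interior hs (mem_univ t) hst
    rw [slope_def_field, le_div_iff₀ (sub_pos.2 hst)] at this
    linarith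
  · simp
  · have := (hp.slope_le_leftDeriv_of_mem_interior (mem_univ t) hs hst).trans
      (hp.leftDeriv_le_rightDeriv_of_mem_interior hs)
    rw [slope_def_field, div_le_iff₀ (sub_pos.2 hst)] at this
    linarith

/-- Convex theorem of the alternative for two functions. -/
theorem exists_multipliers_of_convexOn {φ ψ : X → ℝ} (hφ : ConvexOn ℝ univ φ)
    (hψ : ConvexOn ℝ univ ψ) (h : ∀ z, φ z < 0 → 0 ≤ ψ z) :
    ∃ a b : ℝ, 0 ≤ a ∧ 0 ≤ b ∧ (a ≠ 0 ∨ b ≠ 0) ∧ ∀ z, 0 ≤ a * φ z + b * ψ z := by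
  let C : Set (ℝ × ℝ) := {p | ∃ z, φ z < p.1 ∧ ψ z < p.2}
  have hCo : IsOpen C := by
    have : C = ⋃ z, Ioi (φ z) ×ˢ Ioi (ψ z) := by ext p; simp [C]
    rw [this]
    exact isOpen_iUnion fun z => isOpen_Ioi.prod isOpen_Ioi
  have hCc : Convex ℝ C := by
    rintro p ⟨z, hz₁, hz₂⟩ q ⟨y, hy₁, hy₂⟩ s t hs ht hst
    have key : ∀ {a b c d : ℝ}, a < c → b < d → s * a + t * b < s * c + t * d := by
      intro a b c d hac hbd
      rcases hs.eq_or_lt with rfl | hs'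
      · have : t = 1 := by linarith
        simpa [this] using hbd
      · have := mul_lt_mul_of_pos_left hac hs'
        have := mul_le_mul_of_nonneg_left hbd.le ht
        linarith
    refine ⟨s • z + t • y, ?_, ?_⟩
    · exact (hφ.2 (mem_univ z) (mem_univ y) hs ht hst).trans_lt (by simpa using key hz₁ hy₁)
    · exact (hψ.2 (mem_univ z) (mem_univ y) hs ht hst).trans_lt (by simpa using key hz₂ hy₂)
  have h0 : (0 : ℝ × ℝ) ∉ C := fun ⟨z, h₁, h₂⟩ => (h z h₁).not_gt h₂
  obtain ⟨F, hF⟩ := geometric_hahn_banach_point_open hCc hCo h0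
  have hFe : ∀ r s : ℝ, F (r, s) = F (1, 0) * r + F (0, 1) * s := by
    intro r s
    have : ((r, s) : ℝ × ℝ) = r • (1, 0) + s • (0, 1) := by simp
    rw [this, map_add, map_smul, map_smul]
    simp [mul_comm]
  have hpos : ∀ z, ∀ r > 0, ∀ s > 0, 0 < F (1, 0) * (φ z + r) + F (0, 1) * (ψ z + s) := by
    intro z r hr s hs
    rw [← hFe]
    simpa using hF (φ z + r, ψ z + s) ⟨z, by simpa using hr, by simpa using hs⟩
  generalize F (1, 0) = a at hpos
  generalize F (0, 1) = b at hpos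
  have hlim : ∀ z, ∀ r ≥ 0, ∀ s ≥ 0, 0 ≤ a * (φ z + r) + b * (ψ z + s) := by
    intro z r hr s hs
    have hc : Continuous fun e : ℝ => a * (φ z + (r + e)) + b * (ψ z + (s + e)) := by fun_prop
    have ht := (hc.tendsto 0).mono_left (nhdsWithin_le_nhds (s := Ioi 0))
    simp only [add_zero] at ht
    refine ge_of_tendsto ht ?_
    filter_upwards [self_mem_nhdsWithin] with e (he : 0 < e)
    exact (hpos z (r + e) (by linarith) (s + e) (by linarith)).le
  have hunb : ∀ c d : ℝ, (∀ r ≥ 0, 0 ≤ d + c * r) → 0 ≤ c := by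
    intro c d hcd
    by_contra! hc
    have hq := mul_div_cancel₀ (|d| + 1) hc.ne
    have := hcd (-((|d| + 1) / c)) (by
      rw [ge_iff_le, neg_nonneg]
      exact div_nonpos_of_nonneg_of_nonpos (by positivity) hc.le)
    have := le_abs_self d
    linarith
  refine ⟨a, b, hunb a (a * φ 0 + b * ψ 0) fun r hr => ?_,
    hunb b (a * φ 0 + b * ψ 0) fun r hr => ?_, ?_, fun z => ?_⟩
  · linarith [hlim 0 r hr 0 le_rfl]
  · linarith [hlim 0 0 le_rfl r hr]
  · by_contra! hab
    have := hpos 0 1 one_pos 1 one_pos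
    simp [hab.1, hab.2] at this
  · simpa using hlim z 0 le_rfl 0 le_rfl

/-- Karush-Kuhn-Tucker conditions for one convex constraint satisfying Slater's condition. -/
theorem exists_multiplier_of_slater [CompleteSpace X] {f g : X → ℝ} {x : X}
    (hf : DifferentiableAt ℝ f x) (hg : ConvexOn ℝ univ g)
    (hmin : IsLocalMinOn f {z | g z ≤ g x} x) (hslater : ∃ y, g y < g x) :
    ∃ l : ℝ, 0 ≤ l ∧ ∀ z, 0 ≤ inner ℝ (gradient f x) (z - x) + l * (g z - g x) := by
  have hdir : ∀ z, g z ≤ g x → 0 ≤ inner ℝ (gradient f x) (z - x) := by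
    intro z hz
    rw [inner_gradient_left]
    refine hmin.hasFDerivWithinAt_nonneg hf.hasFDerivAt.hasFDerivWithinAt
      (sub_mem_posTangentConeAt_of_segment_subset ?_)
    have hconv : Convex ℝ {z | g z ≤ g x} := by simpa using hg.convex_le (g x)
    exact hconv.segment_subset (le_refl (g x)) hz
  have hlin : ConvexOn ℝ univ fun z => inner ℝ (gradient f x) (z - x) := by
    refine ⟨convex_univ, fun y _ z _ a b ha hb hab => le_of_eq ?_⟩
    simp only [inner_sub_right, inner_add_right, inner_smul_right, smul_eq_mul]
    linear_combination inner ℝ (gradient f x) x * hab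
  obtain ⟨a, b, ha, hb, hab, h⟩ := exists_multipliers_of_convexOn
    (hg.add_const (-g x)) hlin fun z hz => hdir z (by simpa using hz.le)
  obtain ⟨y, hy⟩ := hslater
  have hb' : 0 < b := by
    refine hb.lt_of_ne' fun hb0 => ?_
    have ha' : 0 < a := ha.lt_of_ne' (hab.resolve_right (not_not.2 hb0))
    have := h y
    have := mul_pos ha' (sub_pos.2 hy)
    simp only [hb0, Pi.add_apply] at *
    linarith
  refine ⟨a / b, by positivity, fun z => ?_⟩
  have hz : 0 ≤ a * (g z + -g x) + b * inner ℝ (gradient f x) (z - x) := h z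
  have : inner ℝ (gradient f x) (z - x) + a / b * (g z - g x) =
      (a * (g z + -g x) + b * inner ℝ (gradient f x) (z - x)) / b := by
    field_simp
    ring
  exact this ▸ div_nonneg hz hb

variable [FiniteDimensional ℝ X]

/-- An affine minorant along a line of a convex function extends to the whole space. -/
theorem exists_subgradient_inner_eq {P : X → ℝ} (hP : ConvexOn ℝ univ P) {x w : X} {d : ℝ}
    (hd : ∀ t : ℝ, P x + t * d ≤ P (x + t • w)) :
    ∃ ξ : X, inner ℝ ξ w = d ∧ ∀ z, P x + inner ℝ ξ (z - x) ≤ P z := by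
  have : CompleteSpace X := FiniteDimensional.complete ℝ X
  have hcont : Continuous P := hP.locallyLipschitz.continuous
  let L : Set (X × ℝ) := range fun t : ℝ => (x + t • w, P x + t * d)
  have hLc : Convex ℝ L := by
    rintro _ ⟨s, rfl⟩ _ ⟨t, rfl⟩ a b ha hb hab
    refine ⟨a * s + b * t, Prod.ext ?_ ?_⟩
    · have : x = a • x + b • x := by rw [← add_smul, hab, one_smul]
      simp only [Prod.smul_mk, Prod.mk_add_mk]
      nth_rewrite 1 [this]
      module
    · simp only [Prod.smul_mk, Prod.mk_add_mk, smul_eq_mul]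
      linear_combination -(P x) * hab
  have hdisj : Disjoint {p : X × ℝ | p.1 ∈ univ ∧ P p.1 < p.2} L := by
    rw [Set.disjoint_left]
    rintro _ ⟨-, h⟩ ⟨t, rfl⟩
    exact (hd t).not_gt h
  have hopen : IsOpen {p : X × ℝ | p.1 ∈ univ ∧ P p.1 < p.2} := by
    simpa using isOpen_lt (hcont.comp continuous_fst) continuous_snd
  obtain ⟨F, u, hFu, huF⟩ := geometric_hahn_banach_open hP.convex_strict_epigraph hopen hLc hdisj
  let l : StrongDual ℝ X := F.comp (ContinuousLinearMap.inl ℝ X ℝ)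
  have hFe : ∀ z r, F (z, r) = l z + r * F (0, 1) := by
    intro z r
    have : ((z, r) : X × ℝ) = (z, 0) + r • (0, 1) := by simp
    rw [this, map_add, map_smul]
    simp [l]
  have hepi : ∀ z, ∀ r > P z, l z + r * F (0, 1) < u := fun z r hr => by
    rw [← hFe]; exact hFu _ ⟨mem_univ _, hr⟩
  have hline : ∀ t : ℝ, u ≤ l x + t * l w + (P x + t * d) * F (0, 1) := fun t => by
    have := huF _ ⟨t, rfl⟩
    rwa [hFe, map_add, map_smul, smul_eq_mul] at this
  generalize F (0, 1) = k at hepi hline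
  have hk : k < 0 := by
    have h₁ := hepi x (P x + 1) (by linarith)
    have h₂ := hline 0
    linarith
  have hgraph : ∀ z, l z + P z * k ≤ u := by
    intro z
    have hc : Continuous fun r : ℝ => l z + r * k := by fun_prop
    refine le_of_tendsto ((hc.tendsto (P z)).mono_left (nhdsWithin_le_nhds (s := Ioi (P z)))) ?_
    filter_upwards [self_mem_nhdsWithin] with r hr
    exact (hepi z r hr).le
  have hnn : ∀ t : ℝ, 0 ≤ t * (l w + d * k) := fun t => by
    linarith [hgraph x, hline t]
  have hlw : l w = d * -k := by linarith [hnn 1, hnn (-1)]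
  refine ⟨(InnerProductSpace.toDual ℝ X).symm ((-k)⁻¹ • l), ?_, fun z => ?_⟩
  · rw [InnerProductSpace.toDual_symm_apply, smul_apply, hlw, smul_eq_mul]
    field_simp [hk.ne]
  · rw [InnerProductSpace.toDual_symm_apply, smul_apply, map_sub, smul_eq_mul,
      ← le_sub_iff_add_le', inv_mul_le_iff₀ (neg_pos.2 hk)]
    linarith [hgraph z, hline 0]

theorem exists_subgradient {P : X → ℝ} (hP : ConvexOn ℝ univ P) (x : X) :
    ∃ ξ : X, ∀ z, P x + inner ℝ ξ (z - x) ≤ P z := by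
  obtain ⟨ξ, -, hξ⟩ := exists_subgradient_inner_eq hP (x := x) (w := 0) (d := 0) (by simp)
  exact ⟨ξ, hξ⟩

/-- If a difference of convex functions decreases along `w`, the second function has a subgradient
at which its linearization makes the convex majorant of the difference decrease along `w`. -/
theorem exists_subgradient_majorant_lt {P₁ P₂ : X → ℝ} (hP₂ : ConvexOn ℝ univ P₂) {x w : X}
    (hw : clarkeDirDeriv (fun y => P₁ y - P₂ y) x w < 0) :
    ∃ ξ : X, (∀ z, P₂ x + inner ℝ ξ (z - x) ≤ P₂ z) ∧ ∃ y, P₁ y - inner ℝ ξ (y - x) < P₁ x := by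
  obtain ⟨b, hb, hlt⟩ := exists_neg_eventually_quotient_lt hw
  let p : ℝ → ℝ := fun t => P₂ (x + t • w)
  have hp : ConvexOn ℝ univ p := by
    refine ⟨convex_univ, fun s _ t _ a c ha hc hac => ?_⟩
    have : x + (a • s + c • t) • w = a • (x + s • w) + c • (x + t • w) := by
      have : x = a • x + c • x := by rw [← add_smul, hac, one_smul]
      nth_rewrite 1 [this]
      module
    simpa only [p, this] using hP₂.2 (mem_univ _) (mem_univ _) ha hc hac
  set d := derivWithin p (Ioi 0) 0
  obtain ⟨ξ, hξw, hξ⟩ := exists_subgradient_inner_eq hP₂ (x := x) (w := w) (d := d) fun t => by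
    simpa [p] using add_mul_rightDeriv_le hp 0 t
  refine ⟨ξ, hξ, ?_⟩
  have hder : Tendsto (slope p 0) (𝓝[>] 0) (𝓝 d) :=
    (hasDerivWithinAt_iff_tendsto_slope' (by simp)).1
      (hp.hasDerivWithinAt_rightDeriv_of_mem_interior (by simp))
  obtain ⟨t, ⟨ht₁, ht₂⟩, ht : 0 < t⟩ :=
    ((hlt.and (hder.eventually_lt_const (show d < d - b by linarith))).and
      self_mem_nhdsWithin).exists
  refine ⟨x + t • w, ?_⟩
  rw [slope_def_field, sub_zero, div_lt_iff₀ ht] at ht₂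
  rw [div_lt_iff₀ ht] at ht₁
  simp only [p, zero_smul, add_zero] at ht₂
  rw [add_sub_cancel_left, inner_smul_right, hξw]
  linarith

theorem stationary_of_inactive {f P₁ P₂ : X → ℝ} {σ : ℝ} (hP₁ : ConvexOn ℝ univ P₁)
    (hP₂ : ConvexOn ℝ univ P₂) {x : X} (hx : IsLocalMinimizer f P₁ P₂ σ x)
    (hlt : P₁ x - P₂ x < σ) : IsStationaryPoint f P₁ P₂ σ x := by
  have : CompleteSpace X := FiniteDimensional.complete ℝ X
  have hnhds : feasibleSet P₁ P₂ σ ∈ 𝓝 x :=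
    mem_of_superset ((isOpen_lt (hP₁.locallyLipschitz.continuous.sub
      hP₂.locallyLipschitz.continuous) continuous_const).mem_nhds hlt) fun z hz =>
      show P₁ z - P₂ z ≤ σ from (show P₁ z - P₂ z < σ from hz).le
  have hgrad : gradient f x = 0 := by
    simp [gradient, (hx.2.isLocalMin hnhds).fderiv_eq_zero]
  obtain ⟨η, hη⟩ := exists_subgradient hP₁ x
  obtain ⟨ξ, hξ⟩ := exists_subgradient hP₂ x
  refine ⟨0, le_rfl, ?_, by simp, hlt.le⟩
  exact ⟨0, hgrad.symm, 0, ⟨η - ξ, ⟨η, mem_limitingSubdifferential_of_subgradient hη,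
    ξ, mem_limitingSubdifferential_of_subgradient hξ, rfl⟩, zero_smul _ _⟩, add_zero _⟩

theorem stationary_of_active {f P₁ P₂ : X → ℝ} {σ : ℝ} (hP₁ : ConvexOn ℝ univ P₁)
    (hP₂ : ConvexOn ℝ univ P₂) {x : X} (hf : DifferentiableAt ℝ f x)
    (hx : IsLocalMinimizer f P₁ P₂ σ x) (heq : P₁ x - P₂ x = σ)
    (hcq : (0 : X) ∉ clarkeSubdifferential (fun y => P₁ y - P₂ y) x) :
    IsStationaryPoint f P₁ P₂ σ x := by
  have : CompleteSpace X := FiniteDimensional.complete ℝ X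
  simp only [clarkeSubdifferential, mem_ofPred_eq, inner_zero_left, EReal.coe_zero, not_forall,
    not_le] at hcq
  obtain ⟨w, hw⟩ := hcq
  obtain ⟨ξ, hξ, y, hy⟩ := exists_subgradient_majorant_lt hP₂ hw
  let g : X → ℝ := fun z => P₁ z - inner ℝ ξ (z - x)
  have hgx : g x = P₁ x := by simp [g]
  have hg : ConvexOn ℝ univ g := by
    refine ⟨convex_univ, fun y _ z _ a b ha hb hab => ?_⟩
    have := hP₁.2 (mem_univ y) (mem_univ z) ha hb hab
    simp only [g, inner_sub_right, inner_add_right, inner_smul_right, smul_eq_mul] at this ⊢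
    linear_combination this - inner ℝ ξ x * hab
  have hsub : {z | g z ≤ g x} ⊆ feasibleSet P₁ P₂ σ := by
    intro z (hz : g z ≤ g x)
    rw [hgx] at hz
    have : P₁ z - P₂ z ≤ σ := by simp only [g] at hz; linarith [hξ z]
    exact this
  obtain ⟨l, hl, hmult⟩ := exists_multiplier_of_slater hf hg (hx.2.on_subset hsub)
    ⟨y, by rwa [hgx]⟩
  rw [hgx] at hmult
  refine ⟨l, hl, ?_, by simp [heq], heq.le⟩
  obtain ⟨η, hη, hsum⟩ : ∃ η : X, (∀ z, P₁ x + inner ℝ η (z - x) ≤ P₁ z) ∧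
      gradient f x + l • (η - ξ) = 0 := by
    rcases hl.eq_or_lt with rfl | hl'
    · obtain ⟨η, hη⟩ := exists_subgradient hP₁ x
      refine ⟨η, hη, ?_⟩
      have := hmult (x - gradient f x)
      rw [sub_sub_cancel_left, inner_neg_right, real_inner_self_eq_norm_sq, zero_mul] at this
      have h0 : ‖gradient f x‖ = 0 := by nlinarith [sq_nonneg ‖gradient f x‖]
      rw [norm_eq_zero.1 h0, zero_smul, add_zero]
    · refine ⟨ξ - l⁻¹ • gradient f x, fun z => ?_, ?_⟩
      · have := mul_nonneg (inv_nonneg.2 hl) (hmult z)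
        rw [mul_add, inv_mul_cancel_left₀ hl'.ne'] at this
        rw [inner_sub_left, real_inner_smul_left]
        simp only [g] at this
        linarith
      · rw [sub_sub_cancel_left, smul_neg, smul_inv_smul₀ hl'.ne', add_neg_cancel]
  exact ⟨_, rfl, _, ⟨_, ⟨η, mem_limitingSubdifferential_of_subgradient hη,
    ξ, mem_limitingSubdifferential_of_subgradient hξ, rfl⟩, rfl⟩, hsum⟩

end DCOpt

theorem mainTheorem8 {X : Type*} [NormedAddCommGroup X] [InnerProductSpace ℝ X]
    [FiniteDimensional ℝ X] (f P₁ P₂ : X → ℝ) (σ : ℝ)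
    (hf : ContDiff ℝ 1 f) (hP₁ : ConvexOn ℝ Set.univ P₁) (hP₂ : ConvexOn ℝ Set.univ P₂)
    (hσ : 0 < σ)
    (hne : (DCOpt.feasibleSet P₁ P₂ σ).Nonempty)
    (hcpt : IsCompact (DCOpt.feasibleSet P₁ P₂ σ))
    (hcq : ∀ x ∈ DCOpt.feasibleSet P₁ P₂ σ, DCOpt.GMFCQAt P₁ P₂ σ x) :
    ∀ x : X, DCOpt.IsLocalMinimizer f P₁ P₂ σ x → DCOpt.IsStationaryPoint f P₁ P₂ σ x := by
  intro x hx
  rcases (show P₁ x - P₂ x ≤ σ from hx.1).lt_or_eq with hlt | heq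
  · exact DCOpt.stationary_of_inactive hP₁ hP₂ hx hlt
  · exact DCOpt.stationary_of_active hP₁ hP₂ (hf.differentiable one_ne_zero x) hx heq
      (hcq x hx.1 heq)
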